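/- Let $\alpha,\beta,\kappa\in\mathbb R$ with $\beta\neq0$ and $\kappa\neq0$, and consider the Kawahara equation (KE) $$u_t+\kappa\,u\,u_x+\alpha\,u_{xxx}-\beta\,u_{xxxxx}=0 .$$ For real $c$ put $$g_2=\frac{169\beta c-22\alpha^2}{2^3\cdot 3\cdot 7\cdot 13^2\,\beta^2},\qquad g_3=\frac{\alpha\,(3\cdot 169\,\beta c-2^7\alpha^2)}{2^5\cdot3^3\cdot5\cdot13^3\,\beta^3},\qquad \Delta=g_2^3-27g_3^2 ,$$ and let $\wp(\,\cdot\,;g_2,g_3)$ be the Weierstrass function with invariants $g_2,g_3$, i.e. the function $\wp$ of a lattice $\Lambda\subset\mathbb C$ with $60\sum_{0\ne\omega\in\Lambda}\omega^{-4}=g_2$ and $140\sum_{0\ne\omega\in\Lambda}\omega^{-6}=g_3$. 1. (General speed.) For every $c\in\mathbb R$ with $\Delta\neq0$ such a lattice exists, and $$u(x,t)=U(x-ct),\qquad U(\xi)=\frac{35}{3\cdot13^2\,\kappa\beta}\Big[\alpha-2^2\cdot3\cdot13\,\beta\,\wp(\xi;g_2,g_3)\Big]^2 ,$$ is real-valued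 and is a classical solution of KE at all real $(x,t)$ for which $x-ct$ is not a pole of $\wp$. Moreover, off the poles the profile satisfies the integrated equation $-cU+\frac{\kappa}{2}U^2+\alpha U''-\beta U''''=\mathcal A$ with the boundary constant $$\mathcal A=\frac{(36\alpha^2-169\beta c)(2^2\cdot3^3\cdot17\,\alpha^2+5\cdot169\,\beta c)}{2^3\cdot7\cdot13^4\,\kappa\beta^2}.$$ 2. (Equianharmonic case.) $g_2=0$ if and only if $c=\dfrac{22\alpha^2}{169\beta}$, and then $g_3=-\dfrac{31\alpha^3}{2^4\cdot3^3\cdot5\cdot13^3\,\beta^3}$. If $\alpha\ne0$, a lattice with invariants $0$ and this $g_3$ exists, and $$u(x,t)=\frac{35}{3\cdot13^2\,\kappa\beta}\Big[\alpha-2^2\cdot3\cdot13\,\beta\,\wp\Big(x-\tfrac{22\alpha^2}{169\beta}t;\,0,\,-\tfrac{31\alpha^3}{2^4\cdot3^3\cdot5\cdot13^3\beta^3}\Big)\Big]^2$$ is a travelling wave of KE in the same sense as in 1, with $c=\frac{22\alpha^2}{169\beta}$. -/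

import Mathlib

/-- `u = u(x, t)` is a classical solution on the open set `D` of the `(x, t)`-plane of the Kawahara
equation `u_t + κ u u_x + α u_xxx - β u_xxxxx = 0`. -/
structure IsKawaharaSolutionOn (κ α β : ℝ) (u : ℝ → ℝ → ℝ) (D : Set (ℝ × ℝ)) : Prop where
  isOpen : IsOpen D
  contDiffOn : ContDiffOn ℝ 5 (fun p : ℝ × ℝ => u p.1 p.2) D
  equation : ∀ x t : ℝ, (x, t) ∈ D →
    deriv (fun s => u x s) t + κ * u x t * deriv (fun y => u y t) x
      + α * iteratedDeriv 3 (fun y => u y t) x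
      - β * iteratedDeriv 5 (fun y => u y t) x = 0

/-- The period lattice of `L` has Weierstrass invariants `g₂` and `g₃`, so that `L.weierstrassP` is
the Weierstrass function `℘(·; g₂, g₃)`. -/
def HasInvariants (L : PeriodPair) (g₂ g₃ : ℝ) : Prop :=
  L.g₂ = (g₂ : ℂ) ∧ L.g₃ = (g₃ : ℂ)

/-- The invariant `g₂` as a function of the coefficients and of the speed. -/
noncomputable def kawaharaG₂ (α β c : ℝ) : ℝ :=
  (13 ^ 2 * β * c - 22 * α ^ 2) / (2 ^ 3 * 3 * 7 * 13 ^ 2 * β ^ 2)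

/-- The invariant `g₃` as a function of the coefficients and of the speed. -/
noncomputable def kawaharaG₃ (α β c : ℝ) : ℝ :=
  α * (3 * 13 ^ 2 * β * c - 2 ^ 7 * α ^ 2) / (2 ^ 5 * 3 ^ 3 * 5 * 13 ^ 3 * β ^ 3)

/-- The integration constant `𝒜` (the boundary value) of the travelling wave of speed `c`. -/
noncomputable def kawaharaConst (κ α β c : ℝ) : ℝ :=
  (36 * α ^ 2 - 169 * β * c) * (2 ^ 2 * 3 ^ 3 * 17 * α ^ 2 + 5 * 169 * β * c)
    / (2 ^ 3 * 7 * 13 ^ 4 * κ * β ^ 2)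

/-- `(35 / (3·13² κ β)) [α - 2²·3·13 β ℘(ξ)]²` is, for real `ξ` off the poles of `℘`, the profile of
a real travelling wave of speed `c` of the Kawahara equation: it is real, `U (x - c t)` solves the
equation wherever `x - c t` is not a pole, and `U` solves the once integrated equation
`-c U + (κ/2) U² + α U'' - β U'''' = 𝒜`. -/
def IsKawaharaWeierstrassWave (κ α β c : ℝ) (L : PeriodPair) : Prop :=
  ∃ U : ℝ → ℝ,
    (∀ ξ : ℝ, (ξ : ℂ) ∉ L.lattice →
      (U ξ : ℂ) = 35 / (3 * 13 ^ 2 * (κ : ℂ) * β)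
        * ((α : ℂ) - 2 ^ 2 * 3 * 13 * β * L.weierstrassP (ξ : ℂ)) ^ 2) ∧
    IsKawaharaSolutionOn κ α β (fun x t => U (x - c * t))
      {p : ℝ × ℝ | ((p.1 - c * p.2 : ℝ) : ℂ) ∉ L.lattice} ∧
    ∀ ξ : ℝ, (ξ : ℂ) ∉ L.lattice →
      -c * U ξ + κ / 2 * U ξ ^ 2 + α * iteratedDeriv 2 U ξ - β * iteratedDeriv 4 U ξ
        = kawaharaConst κ α β c

/-!
The theorem has two halves, the existence of a lattice with the given real invariants and the
verification of the equation for every such lattice.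

Existence (`PeriodPair.exists_g₂_g₃_eq`). The invariants of `ℤ τ + ℤ` are
`g₂ = (4π⁴/3) E₄(τ)` and `g₃ = (8π⁶/27) E₆(τ)`, and `E₄³ - E₆² = 1728 Δ` never vanishes. A homothety
of the lattice multiplies `(g₂, g₃)` by `(μ², μ³)` with an arbitrary `μ ≠ 0`, so that only the ratio
`E₄³ : E₆²` has to be matched. As the prescribed invariants are real, the full surjectivity of `j`
is not needed: on the lines `Re τ = 0` and `Re τ = 1/2` the lattice is stable under complex
conjugation, so `E₄` and `E₆` are real there, and the ratio tends to `1` at `i∞`. At `τ = i` one has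
`E₆ = 0 < E₄`, while at `τ = (1 + i)/2`, whose lattice is homothetic to that of `i`, one has
`E₆ = 0 > E₄`. The intermediate value theorem on the two half-lines above these points therefore
yields every ratio different from `1` (`PeriodPair.exists_E₄_pow_three_mul_eq`).

Verification. Differentiating `℘'² = 4 ℘³ - g₂ ℘ - g₃` and cancelling `℘'` gives
`℘'' = 6 ℘² - g₂/2` (`PeriodPair.hasDerivAt_derivWeierstrassP`). The function `℘` is determined by
its invariants (`PeriodPair.weierstrassP_eq_of_g₂_eq_of_g₃_eq`), by an argument with the indicial
equation at the pole `0`; hence for real invariants it commutes with complex conjugation, and it is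
real on the real axis (`PeriodPair.ofReal_re_weierstrassP`). Consequently, the derivatives of even
order of a polynomial in `℘` are again polynomials in `℘`, the integrated equation becomes the
polynomial identity `kawaharaProfile_equation`, and the Kawahara equation follows by differentiating once more.
-/

/-! ### Lattices: homotheties, complex conjugation and the Eisenstein sums -/

namespace PeriodPair

open scoped ComplexConjugate

/-- The pair of periods `(c ω₁, c ω₂)`, whose lattice is the homothetic copy `c Λ`. -/
noncomputable def scale (L : PeriodPair) (c : ℂ) (hc : c ≠ 0) : PeriodPair where
  ω₁ := c * L.ω₁
  ω₂ := c * L.ω₂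
  indep := by
    rw [LinearIndependent.pair_iff]
    intro s t h
    refine LinearIndependent.pair_iff.mp L.indep s t (mul_left_cancel₀ hc ?_)
    simp only [Complex.real_smul] at h ⊢
    linear_combination h

/-- The pair of complex conjugate periods, whose lattice is the complex conjugate of `Λ`. -/
noncomputable def conjPair (L : PeriodPair) : PeriodPair where
  ω₁ := conj L.ω₁
  ω₂ := conj L.ω₂
  indep := by
    rw [LinearIndependent.pair_iff]
    intro s t h
    refine LinearIndependent.pair_iff.mp L.indep s t ?_
    simpa using congrArg (starRingEnd ℂ) h

lemma mul_mem_lattice_scale (L : PeriodPair) {c : ℂ} (hc : c ≠ 0) (z : ℂ) :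
    c * z ∈ (L.scale c hc).lattice ↔ z ∈ L.lattice := by
  simp only [mem_lattice, scale]
  refine exists_congr fun m => exists_congr fun n => ?_
  rw [show (m : ℂ) * (c * L.ω₁) + n * (c * L.ω₂) = c * (m * L.ω₁ + n * L.ω₂) by ring,
    mul_right_inj' hc]

lemma conj_mem_lattice_conjPair (L : PeriodPair) (z : ℂ) :
    conj z ∈ L.conjPair.lattice ↔ z ∈ L.lattice := by
  simp only [mem_lattice, conjPair]
  refine exists_congr fun m => exists_congr fun n => ?_
  rw [← (starRingEnd ℂ).injective.eq_iff (b := z)]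
  simp

/-- `G n` is homogeneous of degree `-n`; only the lattices matter, not the chosen periods. -/
lemma G_of_mul_mem_lattice_iff {L L' : PeriodPair} {c : ℂ} (hc : c ≠ 0)
    (h : ∀ z, c * z ∈ L'.lattice ↔ z ∈ L.lattice) (n : ℕ) : c ^ n * L'.G n = L.G n := by
  let e : L.lattice ≃ L'.lattice :=
    { toFun := fun l => ⟨c * l, (h _).2 l.2⟩
      invFun := fun l => ⟨c⁻¹ * l, (h _).1 (by rw [mul_inv_cancel_left₀ hc]; exact l.2)⟩
      left_inv := fun l => by ext; simp [hc]
      right_inv := fun l => by ext; simp [hc] }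
  rw [G, G, ← e.tsum_eq, ← tsum_mul_left]
  refine tsum_congr fun l => ?_
  simp only [e, Equiv.coe_fn_mk, mul_pow, mul_inv]
  field_simp

/-- The bijection from a lattice to its complex conjugate given by complex conjugation. -/
noncomputable def conjLatticeEquiv (L : PeriodPair) : L.lattice ≃ L.conjPair.lattice where
  toFun l := ⟨conj l.1, (L.conj_mem_lattice_conjPair _).2 l.2⟩
  invFun l := ⟨conj l.1, (L.conj_mem_lattice_conjPair _).1 (by simp)⟩
  left_inv l := by ext; simp
  right_inv l := by ext; simp

lemma G_conjPair (L : PeriodPair) (n : ℕ) : L.conjPair.G n = conj (L.G n) := by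
  rw [G, G, Complex.conj_tsum, ← L.conjLatticeEquiv.tsum_eq]
  simp [conjLatticeEquiv]

lemma weierstrassP_conjPair (L : PeriodPair) (z : ℂ) :
    L.conjPair.weierstrassP (conj z) = conj (L.weierstrassP z) := by
  rw [weierstrassP, weierstrassP, Complex.conj_tsum, ← L.conjLatticeEquiv.tsum_eq]
  simp [conjLatticeEquiv]

lemma g₂_scale (L : PeriodPair) {c : ℂ} (hc : c ≠ 0) : c ^ 4 * (L.scale c hc).g₂ = L.g₂ := by
  rw [g₂, g₂, ← G_of_mul_mem_lattice_iff hc (L.mul_mem_lattice_scale hc) 4]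
  ring

lemma g₃_scale (L : PeriodPair) {c : ℂ} (hc : c ≠ 0) : c ^ 6 * (L.scale c hc).g₃ = L.g₃ := by
  rw [g₃, g₃, ← G_of_mul_mem_lattice_iff hc (L.mul_mem_lattice_scale hc) 6]
  ring

/-- `G n` is real for a lattice invariant under complex conjugation. -/
lemma conj_G_of_conj_mem_lattice (L : PeriodPair) (h : ∀ z ∈ L.lattice, conj z ∈ L.lattice)
    (n : ℕ) : conj (L.G n) = L.G n := by
  rw [← G_conjPair]
  have hiff : ∀ z, 1 * z ∈ L.lattice ↔ z ∈ L.conjPair.lattice := fun z => by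
    have h1 := L.conj_mem_lattice_conjPair (conj z)
    rw [Complex.conj_conj] at h1
    rw [one_mul, h1]
    exact ⟨h z, fun hz => by simpa using h _ hz⟩
  simpa using (G_of_mul_mem_lattice_iff one_ne_zero hiff n).symm

end PeriodPair

/-! ### Lattices with prescribed real invariants -/

lemma riemannZeta_six : riemannZeta 6 = (Real.pi : ℂ) ^ 6 / 945 := by
  have h := riemannZeta_two_mul_nat (k := 3) (by norm_num)
  have hb : bernoulli 6 = 1 / 42 := by decide +kernel
  norm_num [hb, Nat.factorial] at h
  rw [h]; ring

namespace PeriodPair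

open UpperHalfPlane ModularForm EisensteinSeries Filter Topology
open scoped ComplexConjugate

/-- The periods `(τ, 1)` of the lattice `ℤ τ + ℤ`. -/
noncomputable def ofUpperHalfPlane (τ : ℍ) : PeriodPair where
  ω₁ := τ
  ω₂ := 1
  indep := by
    rw [LinearIndependent.pair_iff]
    intro s t h
    have him := congrArg Complex.im h
    have hre := congrArg Complex.re h
    simp only [Complex.real_smul, Complex.add_im, Complex.add_re, Complex.mul_im, Complex.mul_re,
      Complex.ofReal_re, Complex.ofReal_im, Complex.one_re, Complex.one_im, Complex.zero_re,
      Complex.zero_im, coe_im] at him hre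
    have hs : s = 0 := by simpa [τ.im_ne_zero] using him
    subst hs
    simpa using hre

/-- The normalised `E` is half of the sum over coprime pairs, whence the factor `2 ζ(k)`. -/
lemma G_ofUpperHalfPlane (τ : ℍ) {k : ℕ} (hk : 3 ≤ k) :
    (ofUpperHalfPlane τ).G k = 2 * riemannZeta k * E hk τ := by
  have hE : E hk τ = (1 / 2 : ℂ) * eisensteinSeries (N := 1) 0 k τ := rfl
  rw [hE, show 2 * riemannZeta k * ((1 / 2 : ℂ) * eisensteinSeries (N := 1) 0 k τ)
    = riemannZeta k * eisensteinSeries (N := 1) 0 k τ by ring,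
    ← tsum_eisSummand_eq_riemannZeta_mul_eisensteinSeries hk, G,
    ← ((finTwoArrowEquiv ℤ).trans
      (ofUpperHalfPlane τ).latticeEquivProd.symm.toEquiv).tsum_eq]
  refine tsum_congr fun v => ?_
  have hv := (ofUpperHalfPlane τ).latticeEquiv_symm_apply (v 0, v 1)
  change ((((ofUpperHalfPlane τ).latticeEquivProd.symm (v 0, v 1)).1) ^ k)⁻¹ = _
  rw [hv]
  simp [eisSummand, ofUpperHalfPlane, zpow_neg]

lemma g₂_ofUpperHalfPlane (τ : ℍ) :
    (ofUpperHalfPlane τ).g₂ = 4 * (Real.pi : ℂ) ^ 4 / 3 * E₄ τ := by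
  rw [g₂, G_ofUpperHalfPlane τ (k := 4) (by norm_num)]
  push_cast
  rw [riemannZeta_four]
  ring

lemma g₃_ofUpperHalfPlane (τ : ℍ) :
    (ofUpperHalfPlane τ).g₃ = 8 * (Real.pi : ℂ) ^ 6 / 27 * E₆ τ := by
  rw [g₃, G_ofUpperHalfPlane τ (k := 6) (by norm_num)]
  push_cast
  rw [riemannZeta_six]
  ring

lemma E₄_pow_three_ne_E₆_sq (τ : ℍ) : E₄ τ ^ 3 ≠ E₆ τ ^ 2 := by
  intro h
  apply discriminant_ne_zero τ
  rw [← CuspForm.coe_discriminant]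
  have := discriminant_eq_E₄_cube_sub_E₆_sq τ
  simpa [h] using this

lemma tendsto_E_atImInfty {k : ℕ} (hk : 3 ≤ k) (hk2 : Even k) :
    Tendsto (E hk : ℍ → ℂ) atImInfty (𝓝 1) := by
  have hanal := ModularFormClass.analyticAt_cuspFunction_zero (E hk) one_pos
    one_mem_strictPeriods_SL
  have h0 : cuspFunction 1 (E hk) 0 = 1 := by
    rw [← EisensteinSeries.E_qExpansion_coeff_zero hk hk2, qExpansion_coeff]
    simp
  rw [← h0]
  exact (hanal.continuousAt.tendsto.comp (qParam_tendsto_atImInfty one_pos)).congr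
    (fun τ ↦ SlashInvariantFormClass.eq_cuspFunction (E hk) τ one_mem_strictPeriods_SL one_ne_zero)

lemma conj_mem_lattice_ofUpperHalfPlane {τ : ℍ} {m : ℤ} (hτ : 2 * τ.re = m) (z : ℂ)
    (hz : z ∈ (ofUpperHalfPlane τ).lattice) : conj z ∈ (ofUpperHalfPlane τ).lattice := by
  obtain ⟨p, q, rfl⟩ := mem_lattice.1 hz
  refine mem_lattice.2 ⟨-p, q + p * m, ?_⟩
  have h : conj (τ : ℂ) = m - τ := by
    rw [eq_sub_iff_add_eq, add_comm, Complex.add_conj, coe_re, hτ, Complex.ofReal_intCast]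
  simp only [ofUpperHalfPlane, map_add, map_mul, map_intCast, map_one, h]
  push_cast
  ring

/-- On the vertical lines `2 Re τ ∈ ℤ` the lattice is invariant under complex conjugation, hence
the Eisenstein series are real there. -/
lemma exists_ofReal_eq_E₄_E₆ {τ : ℍ} {m : ℤ} (hτ : 2 * τ.re = m) :
    (((E₄ τ).re : ℝ) : ℂ) = E₄ τ ∧ (((E₆ τ).re : ℝ) : ℂ) = E₆ τ := by
  have h (n) := conj_G_of_conj_mem_lattice _ (conj_mem_lattice_ofUpperHalfPlane hτ) n
  constructor <;> rw [← Complex.conj_eq_iff_re]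
  · have h4 : conj (ofUpperHalfPlane τ).g₂ = (ofUpperHalfPlane τ).g₂ := by
      rw [g₂, map_mul, h, map_ofNat]
    rw [g₂_ofUpperHalfPlane, map_mul, show 4 * (Real.pi : ℂ) ^ 4 / 3
      = ((4 * Real.pi ^ 4 / 3 : ℝ) : ℂ) by push_cast; rfl, Complex.conj_ofReal] at h4
    exact mul_left_cancel₀ (Complex.ofReal_ne_zero.2 (by positivity)) h4
  · have h6 : conj (ofUpperHalfPlane τ).g₃ = (ofUpperHalfPlane τ).g₃ := by
      rw [g₃, map_mul, h, map_ofNat]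
    rw [g₃_ofUpperHalfPlane, map_mul, show 8 * (Real.pi : ℂ) ^ 6 / 27
      = ((8 * Real.pi ^ 6 / 27 : ℝ) : ℂ) by push_cast; rfl, Complex.conj_ofReal] at h6
    exact mul_left_cancel₀ (Complex.ofReal_ne_zero.2 (by positivity)) h6

/-- The point `σ + i eˢ` of the upper half plane. The exponential makes the whole real line a
parameter of the vertical half-line over `σ`, with `s → ∞` corresponding to `i∞`. -/
noncomputable def verticalLine (σ s : ℝ) : ℍ := ⟨σ + Real.exp s * Complex.I, by
  simpa [← Complex.ofReal_exp] using Real.exp_pos s⟩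

lemma coe_verticalLine (σ s : ℝ) : (verticalLine σ s : ℂ) = σ + Real.exp s * Complex.I := rfl

lemma verticalLine_re (σ s : ℝ) : (verticalLine σ s).re = σ := by
  rw [← coe_re, coe_verticalLine]
  simp [-Complex.ofReal_exp]

lemma verticalLine_im (σ s : ℝ) : (verticalLine σ s).im = Real.exp s := by
  rw [← coe_im, coe_verticalLine]
  simp [-Complex.ofReal_exp]

lemma continuous_verticalLine (σ : ℝ) : Continuous (verticalLine σ) := by
  rw [isEmbedding_coe.continuous_iff]
  change Continuous fun s : ℝ => (σ : ℂ) + (Real.exp s : ℂ) * Complex.I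
  fun_prop

lemma tendsto_verticalLine (σ : ℝ) : Tendsto (verticalLine σ) atTop atImInfty := by
  rw [atImInfty, tendsto_comap_iff]
  exact Real.tendsto_exp_atTop.congr fun s => (verticalLine_im σ s).symm

lemma coe_verticalLine_zero_zero : (verticalLine 0 0 : ℂ) = Complex.I := by
  simp [coe_verticalLine]

lemma coe_verticalLine_half : (verticalLine (1 / 2) (-Real.log 2) : ℂ) = (1 + Complex.I) / 2 := by
  rw [coe_verticalLine, Real.exp_neg, Real.exp_log (by norm_num)]
  push_cast
  ring

/-- The Gaussian integers are stable under multiplication by `i`, and `i⁶ = -1`. -/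
lemma E₆_I : E₆ (verticalLine 0 0) = 0 := by
  have hI (z : ℂ) : Complex.I * z ∈ (ofUpperHalfPlane (verticalLine 0 0)).lattice ↔
      z ∈ (ofUpperHalfPlane (verticalLine 0 0)).lattice := by
    simp only [mem_lattice, ofUpperHalfPlane, coe_verticalLine_zero_zero]
    constructor
    · rintro ⟨m, n, h⟩
      refine ⟨-n, m, mul_left_cancel₀ Complex.I_ne_zero ?_⟩
      push_cast
      linear_combination h - (n : ℂ) * Complex.I_sq
    · rintro ⟨m, n, rfl⟩
      exact ⟨n, -m, by push_cast; linear_combination -(m : ℂ) * Complex.I_sq⟩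
  have h := G_of_mul_mem_lattice_iff Complex.I_ne_zero hI 6
  have h6 : Complex.I ^ 6 = -1 := by
    rw [show 6 = 2 * 3 from rfl, pow_mul, Complex.I_sq]; norm_num
  have h0 : (ofUpperHalfPlane (verticalLine 0 0)).g₃ = 0 := by
    rw [g₃]
    linear_combination (-70 : ℂ) * h + 70 * (ofUpperHalfPlane (verticalLine 0 0)).G 6 * h6
  simpa [g₃_ofUpperHalfPlane] using h0

/-- The homothety `1 + i` maps the lattice of `(1 + i) / 2` onto the Gaussian integers, and
`(1 + i)⁴ = -4`. -/
lemma E₄_E₆_half :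
    E₄ (verticalLine (1 / 2) (-Real.log 2)) = -4 * E₄ (verticalLine 0 0) ∧
    E₆ (verticalLine (1 / 2) (-Real.log 2)) = 0 := by
  have hne : 1 + Complex.I ≠ 0 := fun h => by simpa using congrArg Complex.re h
  have hI (z : ℂ) : (1 + Complex.I) * z ∈ (ofUpperHalfPlane (verticalLine 0 0)).lattice ↔
      z ∈ (ofUpperHalfPlane (verticalLine (1 / 2) (-Real.log 2))).lattice := by
    simp only [mem_lattice, ofUpperHalfPlane, coe_verticalLine_zero_zero, coe_verticalLine_half]
    constructor
    · rintro ⟨m, n, h⟩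
      refine ⟨m - n, n, mul_left_cancel₀ hne ?_⟩
      push_cast
      linear_combination h + ((m - n : ℂ) / 2) * Complex.I_sq
    · rintro ⟨m, n, rfl⟩
      refine ⟨m + n, n, ?_⟩
      push_cast
      linear_combination -((m : ℂ) / 2) * Complex.I_sq
  have hsq : (1 + Complex.I) ^ 2 = 2 * Complex.I := by
    linear_combination Complex.I_sq
  have h4 : (1 + Complex.I) ^ 4 = -4 := by
    linear_combination ((1 + Complex.I) ^ 2 + 2 * Complex.I) * hsq + 4 * Complex.I_sq
  constructor
  · have h := G_of_mul_mem_lattice_iff hne hI 4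
    have h0 : (ofUpperHalfPlane (verticalLine (1 / 2) (-Real.log 2))).g₂
        = -4 * (ofUpperHalfPlane (verticalLine 0 0)).g₂ := by
      rw [g₂, g₂, ← h, h4]; ring
    rw [g₂_ofUpperHalfPlane, g₂_ofUpperHalfPlane] at h0
    refine mul_left_cancel₀ (a := 4 * (Real.pi : ℂ) ^ 4 / 3) (by simp) ?_
    linear_combination h0
  · have h := G_of_mul_mem_lattice_iff hne hI 6
    have h0 : (ofUpperHalfPlane (verticalLine (1 / 2) (-Real.log 2))).g₃
        = (1 + Complex.I) ^ 6 * (ofUpperHalfPlane (verticalLine 0 0)).g₃ := by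
      rw [g₃, g₃, ← h]; ring
    rw [g₃_ofUpperHalfPlane, g₃_ofUpperHalfPlane, E₆_I] at h0
    simpa using h0

/-- The `q`-expansion `E₄ = 1 + 240 ∑ σ₃(n) qⁿ` has positive terms at `τ = i`. -/
lemma E₄_I_re_pos : 0 < (E₄ (verticalLine 0 0)).re := by
  have h := EisensteinSeries.q_expansion_bernoulli (k := 4) (by norm_num) ⟨2, rfl⟩
    (verticalLine 0 0)
  rw [show bernoulli 4 = -1 / 30 by decide +kernel, coe_verticalLine_zero_zero] at h
  have hq : Complex.exp (2 * Real.pi * Complex.I * Complex.I)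
      = ((Real.exp (-(2 * Real.pi)) : ℝ) : ℂ) := by
    push_cast
    congr 1
    linear_combination (2 * Real.pi : ℂ) * Complex.I_sq
  have hsum : ∑' n : ℕ+, (ArithmeticFunction.sigma (4 - 1) n : ℂ)
        * Complex.exp (2 * Real.pi * Complex.I * Complex.I) ^ (n : ℤ)
      = ((∑' n : ℕ+, (ArithmeticFunction.sigma (4 - 1) n : ℝ)
        * Real.exp (-(2 * Real.pi)) ^ (n : ℤ) : ℝ) : ℂ) := by
    rw [hq]
    push_cast
    rfl
  have hnn : 0 ≤ ∑' n : ℕ+, (ArithmeticFunction.sigma (4 - 1) n : ℝ)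
        * Real.exp (-(2 * Real.pi)) ^ (n : ℤ) := tsum_nonneg fun n => by positivity
  rw [hsum] at h
  have h' : E₄ (verticalLine 0 0) = ((1 + 240 * ∑' n : ℕ+,
      (ArithmeticFunction.sigma (4 - 1) n : ℝ) * Real.exp (-(2 * Real.pi)) ^ (n : ℤ) : ℝ) : ℂ) := by
    rw [h]
    push_cast
    ring
  rw [h', Complex.ofReal_re]
  linarith

/-- `E₄³ b² - a³ E₆²` tends to `b² - a³` at `i∞` along each vertical line. -/
lemma tendsto_verticalLine_E₄_E₆ (σ a b : ℝ) :
    Tendsto (fun s => (E₄ (verticalLine σ s)).re ^ 3 * b ^ 2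
      - a ^ 3 * (E₆ (verticalLine σ s)).re ^ 2) atTop (𝓝 (b ^ 2 - a ^ 3)) := by
  have h4 := (Complex.continuous_re.tendsto _).comp
    ((tendsto_E_atImInfty (by norm_num : 3 ≤ 4) ⟨2, rfl⟩).comp (tendsto_verticalLine σ))
  have h6 := (Complex.continuous_re.tendsto _).comp
    ((tendsto_E_atImInfty (by norm_num : 3 ≤ 6) ⟨3, rfl⟩).comp (tendsto_verticalLine σ))
  have := ((h4.pow 3).mul_const (b ^ 2)).sub ((h6.pow 2).const_mul (a ^ 3))
  simpa using this

/-- The ratio `E₄³ : E₆²` takes every real value (including `∞`) other than `1` on the half-lines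
`Re τ = 0, Im τ ≥ 1` and `Re τ = 1/2, Im τ ≥ 1/2`. -/
lemma exists_E₄_pow_three_mul_eq (a b : ℝ) (hab : a ^ 3 ≠ b ^ 2) :
    ∃ τ : ℍ, ∃ e₄ e₆ : ℝ, (e₄ : ℂ) = E₄ τ ∧ (e₆ : ℂ) = E₆ τ ∧ e₄ ^ 3 * b ^ 2 = a ^ 3 * e₆ ^ 2 := by
  suffices h : ∃ σ s : ℝ, (∃ m : ℤ, 2 * σ = m) ∧ (E₄ (verticalLine σ s)).re ^ 3 * b ^ 2
      - a ^ 3 * (E₆ (verticalLine σ s)).re ^ 2 = 0 by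
    obtain ⟨σ, s, ⟨m, hm⟩, h⟩ := h
    obtain ⟨h4, h6⟩ := exists_ofReal_eq_E₄_E₆ (τ := verticalLine σ s) (m := m)
      (by rw [verticalLine_re, hm])
    exact ⟨_, _, _, h4, h6, sub_eq_zero.1 h⟩
  have hcont (σ : ℝ) : Continuous fun s => (E₄ (verticalLine σ s)).re ^ 3 * b ^ 2
      - a ^ 3 * (E₆ (verticalLine σ s)).re ^ 2 := by
    have h4 := (ModularFormClass.continuous E₄).comp (continuous_verticalLine σ)
    have h6 := (ModularFormClass.continuous E₆).comp (continuous_verticalLine σ)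
    exact (((Complex.continuous_re.comp h4).pow 3).mul continuous_const).sub
      (continuous_const.mul ((Complex.continuous_re.comp h6).pow 2))
  have hI := E₄_I_re_pos
  rcases lt_or_gt_of_ne hab with h | h
  · obtain ⟨t, ht⟩ := ((tendsto_verticalLine_E₄_E₆ (1 / 2) a b).eventually
      (lt_mem_nhds (sub_pos.2 h))).exists
    obtain ⟨s, hs⟩ := mem_range_of_exists_le_of_exists_ge (hcont (1 / 2)) (c := 0)
      ⟨-Real.log 2, by
        rw [E₄_E₆_half.1, E₄_E₆_half.2]
        have : 0 ≤ (E₄ (verticalLine 0 0)).re ^ 3 * b ^ 2 := by positivity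
        simp
        linarith⟩ ⟨t, ht.le⟩
    exact ⟨1 / 2, s, ⟨1, by norm_num⟩, hs⟩
  · obtain ⟨t, ht⟩ := ((tendsto_verticalLine_E₄_E₆ 0 a b).eventually
      (gt_mem_nhds (sub_neg.2 h))).exists
    obtain ⟨s, hs⟩ := mem_range_of_exists_le_of_exists_ge (hcont 0) (c := 0)
      ⟨t, ht.le⟩ ⟨0, by
        rw [E₆_I]
        have : 0 ≤ (E₄ (verticalLine 0 0)).re ^ 3 * b ^ 2 := by positivity
        simpa using this⟩
    exact ⟨0, s, ⟨0, by norm_num⟩, hs⟩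

/-- Two pairs with the same ratio `x³ : y²`, where this ratio is not `1`, differ by a scaling of
weights `2` and `3`. -/
lemma exists_weighted_scaling {a b x y : ℂ} (hab : a ^ 3 ≠ b ^ 2) (hxy : x ^ 3 ≠ y ^ 2)
    (h : x ^ 3 * b ^ 2 = a ^ 3 * y ^ 2) : ∃ μ : ℂ, μ ≠ 0 ∧ μ ^ 2 * x = a ∧ μ ^ 3 * y = b := by
  by_cases hy : y = 0
  · subst hy
    have hx : x ≠ 0 := fun hx => hxy (by simp [hx])
    have hb : b = 0 := by simpa [hx] using h
    subst hb
    have ha : a ≠ 0 := fun ha => hab (by simp [ha])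
    obtain ⟨μ, hμ⟩ := IsAlgClosed.exists_pow_nat_eq (a / x) (n := 2) (by norm_num)
    refine ⟨μ, fun h0 => ?_, by rw [hμ]; field_simp, by simp⟩
    exact div_ne_zero ha hx (by rw [← hμ, h0]; norm_num)
  by_cases hx : x = 0
  · subst hx
    have ha : a = 0 := by simpa [hy] using h.symm
    subst ha
    have hb : b ≠ 0 := fun hb => hab (by simp [hb])
    obtain ⟨μ, hμ⟩ := IsAlgClosed.exists_pow_nat_eq (b / y) (n := 3) (by norm_num)
    refine ⟨μ, fun h0 => ?_, by simp, by rw [hμ]; field_simp⟩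
    exact div_ne_zero hb hy (by rw [← hμ, h0]; norm_num)
  have ha : a ≠ 0 := fun ha => by
    subst ha
    have hb : b = 0 := by simpa [hx] using h
    exact hab (by simp [hb])
  have hb : b ≠ 0 := fun hb => by
    subst hb
    simp [hy, ha] at h
  refine ⟨(b * x) / (a * y), by simp [*], ?_, ?_⟩
  · field_simp
    linear_combination h
  · field_simp
    linear_combination h

/-- Uniformization for real invariants: real `g₂, g₃` with `g₂³ ≠ 27 g₃²` are the invariants of a
lattice. -/
theorem exists_g₂_g₃_eq (a b : ℝ) (hab : a ^ 3 - 27 * b ^ 2 ≠ 0) :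
    ∃ L : PeriodPair, L.g₂ = a ∧ L.g₃ = b := by
  -- the invariants of `ℤ τ + ℤ` are these multiples of `E₄ τ` and `E₆ τ`
  set p : ℝ := 4 * Real.pi ^ 4 / 3 with hp
  set q : ℝ := 8 * Real.pi ^ 6 / 27 with hq
  have hp0 : p ≠ 0 := by positivity
  have hq0 : q ≠ 0 := by positivity
  have hpq : p ^ 3 = 27 * q ^ 2 := by rw [hp, hq]; ring
  have hne : (a / p) ^ 3 ≠ (b / q) ^ 2 := by
    clear_value p q
    rw [div_pow, div_pow, hpq, Ne, div_eq_div_iff (by positivity) (by positivity)]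
    intro h
    refine hab (mul_right_cancel₀ (pow_ne_zero 2 hq0) ?_)
    linear_combination h
  obtain ⟨τ, x, y, hx, hy, h⟩ := exists_E₄_pow_three_mul_eq _ _ hne
  obtain ⟨μ, hμ0, h2, h3⟩ := exists_weighted_scaling (a := (a / p : ℝ)) (b := (b / q : ℝ))
    (x := x) (y := y) (by exact_mod_cast hne) (by rw [hx, hy]; exact E₄_pow_three_ne_E₆_sq τ)
    (by exact_mod_cast h)
  -- a homothety `c` multiplies `g₂` by `c⁻⁴` and `g₃` by `c⁻⁶`
  obtain ⟨c, hc⟩ := IsAlgClosed.exists_pow_nat_eq μ⁻¹ (n := 2) (by norm_num)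
  have hc0 : c ≠ 0 := by
    rintro rfl
    exact inv_ne_zero hμ0 (by rw [← hc]; norm_num)
  have hμc : μ * c ^ 2 = 1 := by rw [hc, mul_inv_cancel₀ hμ0]
  have hpC : (p : ℂ) ≠ 0 := by exact_mod_cast hp0
  have hqC : (q : ℂ) ≠ 0 := by exact_mod_cast hq0
  refine ⟨(ofUpperHalfPlane τ).scale c hc0, ?_, ?_⟩
  · have h := (ofUpperHalfPlane τ).g₂_scale hc0
    rw [g₂_ofUpperHalfPlane, ← hx, show 4 * (Real.pi : ℂ) ^ 4 / 3 = p by rw [hp]; push_cast; rfl]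
      at h
    refine mul_left_cancel₀ (pow_ne_zero 4 hc0) ?_
    rw [h]
    push_cast at h2
    rw [eq_div_iff hpC] at h2
    rw [← h2]
    linear_combination (-(p : ℂ) * x * (μ * c ^ 2 + 1)) * hμc
  · have h := (ofUpperHalfPlane τ).g₃_scale hc0
    rw [g₃_ofUpperHalfPlane, ← hy, show 8 * (Real.pi : ℂ) ^ 6 / 27 = q by rw [hq]; push_cast; rfl]
      at h
    refine mul_left_cancel₀ (pow_ne_zero 6 hc0) ?_
    rw [h]
    push_cast at h3
    rw [eq_div_iff hqC] at h3
    rw [← h3]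
    linear_combination (-(q : ℂ) * y * ((μ * c ^ 2) ^ 2 + μ * c ^ 2 + 1)) * hμc

end PeriodPair

/-! ### The second order equation of `℘`, and reality for real invariants -/

namespace PeriodPair

open Filter Topology
open scoped ComplexConjugate

lemma countable_lattice (L : PeriodPair) : (L.lattice : Set ℂ).Countable :=
  Set.countable_coe_iff.1 (L.latticeEquivProd.toEquiv.countable_iff.2 inferInstance)

lemma isPreconnected_compl_of_countable {s : Set ℂ} (hs : s.Countable) : IsPreconnected sᶜ :=
  (hs.isConnected_compl_of_one_lt_rank (by rw [Complex.rank_real_complex]; norm_num)).isPreconnected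

lemma isOpen_compl_lattice (L : PeriodPair) : IsOpen (L.lattice : Set ℂ)ᶜ :=
  L.isClosed_lattice.isOpen_compl

lemma eventually_notMem_lattice (L : PeriodPair) : ∀ᶠ z in 𝓝[≠] (0 : ℂ), z ∉ L.lattice := by
  filter_upwards [self_mem_nhdsWithin,
    mem_nhdsWithin_of_mem_nhds (L.compl_lattice_sdiff_singleton_mem_nhds 0)] with z hz hz' h
  exact hz' ⟨h, hz⟩

lemma weierstrassPExcept_zero_eq (L : PeriodPair) (z : ℂ) :
    L.weierstrassPExcept 0 z = L.weierstrassP z - 1 / z ^ 2 := by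
  simpa [sub_eq_add_neg] using L.weierstrassPExcept_def 0 z

lemma hasDerivAt_weierstrassP (L : PeriodPair) {z : ℂ} (hz : z ∉ L.lattice) :
    HasDerivAt L.weierstrassP (L.derivWeierstrassP z) z := by
  rw [← deriv_weierstrassP]
  exact (L.analyticOnNhd_weierstrassP z hz).differentiableAt.hasDerivAt

/-- `℘'` does not vanish identically, because of its pole at `0`. -/
lemma exists_derivWeierstrassP_ne_zero (L : PeriodPair) :
    ∃ z ∉ L.lattice, L.derivWeierstrassP z ≠ 0 := by
  by_contra! h
  have hEv : (fun z : ℂ => z ^ 3 * L.derivWeierstrassPExcept 0 z) =ᶠ[𝓝[≠] 0] fun _ => 2 := by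
    filter_upwards [L.eventually_notMem_lattice, self_mem_nhdsWithin] with z hz hz0
    have hd := L.derivWeierstrassPExcept_def 0 z
    simp only [ZeroMemClass.coe_zero, sub_zero, h z hz, zero_add] at hd
    rw [hd]
    exact mul_div_cancel₀ _ (pow_ne_zero 3 hz0)
  have hlim : Tendsto (fun z : ℂ => z ^ 3 * L.derivWeierstrassPExcept 0 z) (𝓝[≠] 0) (𝓝 0) := by
    have hc : ContinuousAt (fun z : ℂ => z ^ 3 * L.derivWeierstrassPExcept 0 z) 0 :=
      (continuousAt_id.pow 3).mul (L.analyticAt_derivWeierstrassPExcept 0).continuousAt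
    simpa using hc.tendsto.mono_left nhdsWithin_le_nhds
  exact two_ne_zero (tendsto_nhds_unique (tendsto_const_nhds.congr' hEv.symm) hlim)

/-- `℘'' = 6 ℘² - g₂ / 2`: differentiate `℘'² = 4 ℘³ - g₂ ℘ - g₃` and cancel `℘'`, which is
possible by analyticity since the complement of the lattice is connected. -/
lemma hasDerivAt_derivWeierstrassP (L : PeriodPair) {z : ℂ} (hz : z ∉ L.lattice) :
    HasDerivAt L.derivWeierstrassP (6 * L.weierstrassP z ^ 2 - L.g₂ / 2) z := by
  have han := L.analyticOnNhd_derivWeierstrassP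
  have hprod : ∀ w ∈ (L.lattice : Set ℂ)ᶜ, L.derivWeierstrassP w *
      (deriv L.derivWeierstrassP w - (6 * L.weierstrassP w ^ 2 - L.g₂ / 2)) = 0 := by
    intro w hw
    have hP := L.hasDerivAt_weierstrassP hw
    have hP' := (han w hw).differentiableAt.hasDerivAt
    have h1 := hP'.pow 2
    have h2 : HasDerivAt (fun z => L.derivWeierstrassP z ^ 2) _ w :=
      ((((hP.pow 3).const_mul 4).sub (hP.const_mul L.g₂)).sub_const L.g₃).congr_of_eventuallyEq
        (by
          filter_upwards [L.isOpen_compl_lattice.mem_nhds hw] with y hy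
          simpa using L.derivWeierstrassP_sq y hy)
    have h := h1.unique h2
    simp only [Nat.cast_ofNat] at h
    linear_combination h / 2
  have hr : AnalyticOnNhd ℂ (fun w => deriv L.derivWeierstrassP w
      - (6 * L.weierstrassP w ^ 2 - L.g₂ / 2)) (L.lattice : Set ℂ)ᶜ :=
    han.deriv.sub ((analyticOnNhd_const.mul (L.analyticOnNhd_weierstrassP.pow 2)).sub
      analyticOnNhd_const)
  rcases han.eq_zero_or_eq_zero_of_mul_eq_zero hr hprod
    (isPreconnected_compl_of_countable L.countable_lattice) with h | h
  · obtain ⟨w, hw, hne⟩ := L.exists_derivWeierstrassP_ne_zero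
    exact absurd (h w hw) hne
  · rw [← sub_eq_zero.1 (h z hz)]
    exact (han z hz).differentiableAt.hasDerivAt

/-- The indicial equation at the singular point of `z² d'' = a(z) d`: a solution which is analytic
at `0` and vanishes there to an order `n` with `k (k - 1) ≠ a(0)` for all `k ≥ n` is zero. -/
lemma eventually_eq_zero_of_sq_mul_deriv_deriv_eq {d a : ℂ → ℂ} {n : ℕ} (hn : 2 ≤ n)
    (hd : AnalyticAt ℂ d 0) (ha : ContinuousAt a 0) (hord : n ≤ analyticOrderAt d 0)
    (hne : ∀ k : ℕ, n ≤ k → (k * (k - 1) : ℂ) ≠ a 0)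
    (hode : ∀ᶠ z in 𝓝[≠] 0, z ^ 2 * deriv (deriv d) z = a z * d z) : ∀ᶠ z in 𝓝 0, d z = 0 := by
  by_contra hcon
  obtain ⟨k, e, he, he0, hde⟩ := hd.exists_eventuallyEq_pow_smul_nonzero_iff.2 hcon
  have hk : n ≤ k := by
    have := (hd.analyticOrderAt_eq_natCast (n := k)).2 ⟨e, he, he0, hde⟩
    rw [this] at hord
    exact_mod_cast hord
  obtain ⟨m, rfl⟩ : ∃ m, k = m + 2 := ⟨k - 2, by omega⟩
  replace hde : d =ᶠ[𝓝 0] fun z => z ^ (m + 2) * e z :=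
    hde.mono fun z hz => by simpa using hz
  have hd1 : deriv d =ᶠ[𝓝 0] fun z => (m + 2) * z ^ (m + 1) * e z + z ^ (m + 2) * deriv e z := by
    filter_upwards [hde.eventuallyEq_nhds, he.eventually_analyticAt] with z hz hez
    rw [hz.deriv_eq]
    have := ((hasDerivAt_pow (m + 2) z).mul hez.differentiableAt.hasDerivAt).deriv
    push_cast at this
    exact this
  have hd2 : deriv (deriv d) =ᶠ[𝓝 0] fun z => (m + 2) * (m + 1) * z ^ m * e z
      + 2 * (m + 2) * z ^ (m + 1) * deriv e z + z ^ (m + 2) * deriv (deriv e) z := by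
    filter_upwards [hd1.eventuallyEq_nhds, he.eventually_analyticAt] with z hz hez
    rw [hz.deriv_eq]
    have := ((((hasDerivAt_pow (m + 1) z).const_mul ((m : ℂ) + 2)).mul
      hez.differentiableAt.hasDerivAt).add
      ((hasDerivAt_pow (m + 2) z).mul hez.deriv.differentiableAt.hasDerivAt)).deriv
    push_cast at this
    refine this.trans ?_
    ring
  -- divide the equation by `z ^ (m + 2)` and let `z` tend to `0`
  have hEv : (fun z => (m + 2) * (m + 1) * e z + 2 * (m + 2) * z * deriv e z
      + z ^ 2 * deriv (deriv e) z - a z * e z) =ᶠ[𝓝[≠] 0] fun _ => 0 := by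
    filter_upwards [hode, self_mem_nhdsWithin, nhdsWithin_le_nhds hde, nhdsWithin_le_nhds hd2]
      with z h1 hz h2 h3
    refine (mul_right_inj' (pow_ne_zero (m + 2) hz)).1 ?_
    rw [h2, h3] at h1
    linear_combination h1
  have hlim : ContinuousAt (fun z => (m + 2) * (m + 1) * e z + 2 * (m + 2) * z * deriv e z
      + z ^ 2 * deriv (deriv e) z - a z * e z) 0 := by
    have h0 := he.continuousAt
    have h1 := he.deriv.continuousAt
    have h2 := he.deriv.deriv.continuousAt
    fun_prop
  have hzero := tendsto_nhds_unique (tendsto_const_nhds.congr' hEv.symm)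
    (hlim.tendsto.mono_left nhdsWithin_le_nhds)
  refine hne (m + 2) hk (mul_right_cancel₀ he0 ?_)
  push_cast
  linear_combination -hzero

/-- `℘` is determined by `g₂` and `g₃`. Near `0` the difference `d` of two such functions satisfies
`z² d'' = 6 z² (℘₁ + ℘₂) d`, whose coefficient takes the value `12` at `0`, and `d` vanishes to
order `6` because the Laurent coefficients up to degree `4` are multiples of `g₂` and `g₃`. -/
lemma weierstrassP_eq_of_g₂_eq_of_g₃_eq {L L' : PeriodPair} (h₂ : L.g₂ = L'.g₂)
    (h₃ : L.g₃ = L'.g₃) {z : ℂ} (hz : z ∉ L.lattice) (hz' : z ∉ L'.lattice) :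
    L.weierstrassP z = L'.weierstrassP z := by
  set d : ℂ → ℂ := L.weierstrassPExcept 0 - L'.weierstrassPExcept 0 with hd
  have han : AnalyticAt ℂ d 0 :=
    (L.analyticAt_weierstrassPExcept 0).sub (L'.analyticAt_weierstrassPExcept 0)
  have hdeq (w : ℂ) : d w = L.weierstrassP w - L'.weierstrassP w := by
    simp only [hd, Pi.sub_apply, weierstrassPExcept_zero_eq]
    ring
  have hord : ((6 : ℕ) : ℕ∞) ≤ analyticOrderAt d 0 := by
    refine (natCast_le_analyticOrderAt_iff_iteratedDeriv_eq_zero han).2 fun i hi => ?_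
    have hG4 : L.G 4 = L'.G 4 := by simpa [g₂] using h₂
    have hG6 : L.G 6 = L'.G 6 := by simpa [g₃] using h₃
    rw [hd, iteratedDeriv_sub (L.analyticAt_weierstrassPExcept 0).contDiffAt
      (L'.analyticAt_weierstrassPExcept 0).contDiffAt, iteratedDeriv_weierstrassPExcept_self,
      iteratedDeriv_weierstrassPExcept_self]
    simp only [sumInvPow_zero]
    interval_cases i
    · simp
    · simp [G_eq_zero_of_odd _ 3 (by decide)]
    · simp [hG4]
    · simp [G_eq_zero_of_odd _ 5 (by decide)]
    · simp [hG6]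
    · simp [G_eq_zero_of_odd _ 7 (by decide)]
  have hode : ∀ᶠ w in 𝓝[≠] (0 : ℂ), w ^ 2 * deriv (deriv d) w
      = (12 + 6 * w ^ 2 * (L.weierstrassPExcept 0 w + L'.weierstrassPExcept 0 w)) * d w := by
    filter_upwards [L.eventually_notMem_lattice, L'.eventually_notMem_lattice,
      self_mem_nhdsWithin] with w hw hw' hw0
    have hnear : ∀ᶠ y in 𝓝 w, y ∉ L.lattice ∧ y ∉ L'.lattice :=
      (L.isOpen_compl_lattice.eventually_mem hw).and (L'.isOpen_compl_lattice.eventually_mem hw')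
    have h1 : deriv d =ᶠ[𝓝 w] fun y => L.derivWeierstrassP y - L'.derivWeierstrassP y := by
      filter_upwards [hnear] with y hy
      rw [show d = fun y => L.weierstrassP y - L'.weierstrassP y from funext hdeq]
      exact ((L.hasDerivAt_weierstrassP hy.1).sub (L'.hasDerivAt_weierstrassP hy.2)).deriv
    rw [h1.deriv_eq, ((L.hasDerivAt_derivWeierstrassP hw).fun_sub
      (L'.hasDerivAt_derivWeierstrassP hw')).deriv, hdeq, h₂, weierstrassPExcept_zero_eq,
      weierstrassPExcept_zero_eq]
    have hw0' : w ≠ 0 := hw0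
    field_simp
    ring
  have hzero : ∀ᶠ w in 𝓝 0, d w = 0 := by
    refine eventually_eq_zero_of_sq_mul_deriv_deriv_eq (n := 6) (by norm_num) han ?_ hord ?_ hode
    · have h1 := (L.analyticAt_weierstrassPExcept 0).continuousAt
      have h2 := (L'.analyticAt_weierstrassPExcept 0).continuousAt
      fun_prop
    · intro k hk h
      have h' : ((k * (k - 1) : ℝ) : ℂ) = (12 : ℝ) := by
        push_cast
        simpa using h
      have h'' : (k * (k - 1) : ℝ) = 12 := by exact_mod_cast h'
      have hk' : (6 : ℝ) ≤ k := by exact_mod_cast hk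
      nlinarith
  -- continue analytically from a point near `0` to the complement of both lattices
  obtain ⟨w, ⟨hw, hw'⟩, hwd⟩ := ((L.eventually_notMem_lattice.and
    L'.eventually_notMem_lattice).and (nhdsWithin_le_nhds hzero.eventually_nhds)).exists
  have hsub : ((L.lattice : Set ℂ) ∪ L'.lattice)ᶜ ⊆ (L.lattice : Set ℂ)ᶜ :=
    Set.compl_subset_compl.2 Set.subset_union_left
  have hsub' : ((L.lattice : Set ℂ) ∪ L'.lattice)ᶜ ⊆ (L'.lattice : Set ℂ)ᶜ :=
    Set.compl_subset_compl.2 Set.subset_union_right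
  refine (L.analyticOnNhd_weierstrassP.mono hsub).eqOn_of_preconnected_of_eventuallyEq
    (L'.analyticOnNhd_weierstrassP.mono hsub')
    (isPreconnected_compl_of_countable (L.countable_lattice.union L'.countable_lattice))
    (z₀ := w) (fun h => h.elim hw hw') ?_ (fun h => h.elim hz hz')
  filter_upwards [hwd] with y hy
  rw [← sub_eq_zero, ← hdeq, hy]

/-- The conjugate lattice has the conjugate invariants, so `℘` commutes with conjugation when these
are real. -/
lemma ofReal_re_weierstrassP (L : PeriodPair) {a b : ℝ} (h₂ : L.g₂ = a) (h₃ : L.g₃ = b) {ξ : ℝ}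
    (hξ : (ξ : ℂ) ∉ L.lattice) : (((L.weierstrassP ξ).re : ℝ) : ℂ) = L.weierstrassP ξ := by
  have hmem : (ξ : ℂ) ∉ L.conjPair.lattice := by
    rwa [← Complex.conj_ofReal, conj_mem_lattice_conjPair]
  rw [← Complex.conj_eq_iff_re, ← weierstrassP_conjPair, Complex.conj_ofReal]
  refine weierstrassP_eq_of_g₂_eq_of_g₃_eq ?_ ?_ hmem hξ
  · rw [h₂, ← Complex.conj_ofReal a, ← h₂, g₂, g₂, G_conjPair, map_mul, map_ofNat]
  · rw [h₃, ← Complex.conj_ofReal b, ← h₃, g₃, g₃, G_conjPair, map_mul, map_ofNat]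

end PeriodPair

/-! ### The travelling wave -/

section

open Filter Topology Polynomial

/-- The operator on polynomials which describes `d²/dξ²` on functions `p(V)` when
`V'² = 4 V³ - a V - b` and `V'' = 6 V² - a / 2`. -/
noncomputable def weierstrassSecondDeriv (a b : ℝ) (p : ℝ[X]) : ℝ[X] :=
  derivative (derivative p) * (4 * X ^ 3 - C a * X - C b)
    + derivative p * (6 * X ^ 2 - C (a / 2))

lemma hasDerivAt_eval_comp {V W : ℝ → ℝ} {ξ : ℝ} (hV : HasDerivAt V (W ξ) ξ) (p : ℝ[X]) :
    HasDerivAt (fun y => p.eval (V y)) ((derivative p).eval (V ξ) * W ξ) ξ :=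
  (p.hasDerivAt (V ξ)).comp ξ hV

section

variable {S : Set ℝ} {V W : ℝ → ℝ} {a b : ℝ}

lemma iteratedDeriv_two_eval_comp (hS : IsOpen S) (hV : ∀ ξ ∈ S, HasDerivAt V (W ξ) ξ)
    (hW : ∀ ξ ∈ S, HasDerivAt W (6 * V ξ ^ 2 - a / 2) ξ)
    (hsq : ∀ ξ ∈ S, W ξ ^ 2 = 4 * V ξ ^ 3 - a * V ξ - b) (p : ℝ[X]) {ξ : ℝ} (hξ : ξ ∈ S) :
    iteratedDeriv 2 (fun y => p.eval (V y)) ξ = (weierstrassSecondDeriv a b p).eval (V ξ) := by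
  have h1 : deriv (fun y => p.eval (V y)) =ᶠ[𝓝 ξ] fun y => (derivative p).eval (V y) * W y := by
    filter_upwards [hS.mem_nhds hξ] with y hy
    exact (hasDerivAt_eval_comp (hV y hy) p).deriv
  rw [iteratedDeriv_succ, iteratedDeriv_one, h1.deriv_eq,
    ((hasDerivAt_eval_comp (hV ξ hξ) (derivative p)).fun_mul (hW ξ hξ)).deriv]
  simp only [weierstrassSecondDeriv, eval_add, eval_mul, eval_sub, eval_pow, eval_X, eval_C,
    eval_ofNat]
  linear_combination (derivative (derivative p)).eval (V ξ) * hsq ξ hξ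

lemma iteratedDeriv_four_eval_comp (hS : IsOpen S) (hV : ∀ ξ ∈ S, HasDerivAt V (W ξ) ξ)
    (hW : ∀ ξ ∈ S, HasDerivAt W (6 * V ξ ^ 2 - a / 2) ξ)
    (hsq : ∀ ξ ∈ S, W ξ ^ 2 = 4 * V ξ ^ 3 - a * V ξ - b) (p : ℝ[X]) {ξ : ℝ} (hξ : ξ ∈ S) :
    iteratedDeriv 4 (fun y => p.eval (V y)) ξ
      = (weierstrassSecondDeriv a b (weierstrassSecondDeriv a b p)).eval (V ξ) := by
  rw [← iteratedDeriv_two_eval_comp hS hV hW hsq _ hξ]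
  have h : iteratedDeriv 2 (fun y => p.eval (V y))
      =ᶠ[𝓝 ξ] fun y => (weierstrassSecondDeriv a b p).eval (V y) := by
    filter_upwards [hS.mem_nhds hξ] with y hy
    exact iteratedDeriv_two_eval_comp hS hV hW hsq p hy
  rw [← h.iteratedDeriv_eq 2]
  simp only [iteratedDeriv_eq_iterate, ← Function.iterate_add_apply]

end

/-- The profile `(35 / (3·13² κ β)) [α - 2²·3·13 β X]²` as a polynomial in `X = ℘`. -/
noncomputable def kawaharaProfile (κ α β : ℝ) : ℝ[X] :=
  C (35 / (3 * 13 ^ 2 * κ * β)) * (C α - C (2 ^ 2 * 3 * 13 * β) * X) ^ 2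

lemma kawaharaProfile_equation {κ α β : ℝ} (hκ : κ ≠ 0) (hβ : β ≠ 0) (c v : ℝ) :
    -c * (kawaharaProfile κ α β).eval v + κ / 2 * (kawaharaProfile κ α β).eval v ^ 2
      + α * (weierstrassSecondDeriv (kawaharaG₂ α β c) (kawaharaG₃ α β c)
        (kawaharaProfile κ α β)).eval v
      - β * (weierstrassSecondDeriv (kawaharaG₂ α β c) (kawaharaG₃ α β c)
        (weierstrassSecondDeriv (kawaharaG₂ α β c) (kawaharaG₃ α β c)
          (kawaharaProfile κ α β))).eval v
      = kawaharaConst κ α β c := by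
  simp only [weierstrassSecondDeriv, kawaharaProfile, derivative_add, derivative_mul,
    derivative_sub, derivative_C, derivative_X, derivative_pow, derivative_ofNat,
    eval_add, eval_mul, eval_sub, eval_pow, eval_X, eval_C, eval_ofNat, eval_zero, eval_one,
    eval_natCast, map_natCast]
  simp only [kawaharaG₂, kawaharaG₃, kawaharaConst]
  norm_num
  field_simp
  ring

/-- A smooth profile which solves the integrated equation on an open set gives a travelling wave
solution: differentiate once. -/
lemma isKawaharaSolutionOn_of_profile {κ α β c A : ℝ} {U : ℝ → ℝ} {S : Set ℝ} (hS : IsOpen S)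
    (hU : ContDiffOn ℝ 5 U S)
    (hint : ∀ ξ ∈ S, -c * U ξ + κ / 2 * U ξ ^ 2 + α * iteratedDeriv 2 U ξ
      - β * iteratedDeriv 4 U ξ = A) :
    IsKawaharaSolutionOn κ α β (fun x t => U (x - c * t)) {p : ℝ × ℝ | p.1 - c * p.2 ∈ S} where
  isOpen := hS.preimage (by fun_prop)
  contDiffOn := hU.comp (g := U) (f := fun p : ℝ × ℝ => p.1 - c * p.2) (by fun_prop)
    fun p hp => hp
  equation x t hxt := by
    have hat : ContDiffAt ℝ 5 U (x - c * t) := hU.contDiffAt (hS.mem_nhds hxt)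
    have hdiff (m : ℕ) (hm : m < 5) :
        HasDerivAt (iteratedDeriv m U) (iteratedDeriv (m + 1) U (x - c * t)) (x - c * t) := by
      rw [iteratedDeriv_succ]
      refine DifferentiableAt.hasDerivAt ?_
      rw [iteratedDeriv_eq_equiv_comp]
      exact (LinearIsometryEquiv.differentiable _).differentiableAt.comp _
        (hat.differentiableAt_iteratedFDeriv (by exact_mod_cast hm))
    have h0 : HasDerivAt U (deriv U (x - c * t)) (x - c * t) := by
      simpa using hdiff 0 (by norm_num)
    have hd := ((((h0.const_mul (-c)).add ((h0.pow 2).const_mul (κ / 2))).add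
      ((hdiff 2 (by norm_num)).const_mul α)).sub ((hdiff 4 (by norm_num)).const_mul β))
    have hc : HasDerivAt (fun _ : ℝ => A) 0 (x - c * t) := hasDerivAt_const _ _
    have hkey := hd.unique (hc.congr_of_eventuallyEq (by
      filter_upwards [hS.mem_nhds hxt] with ξ hξ
      simpa using hint ξ hξ))
    have ht : deriv (fun s => U (x - c * s)) t = deriv U (x - c * t) * -c := by
      refine (h0.comp t ?_).deriv
      simpa using ((hasDerivAt_id t).const_mul c).const_sub x
    have hx : deriv (fun y => U (y - c * t)) x = deriv U (x - c * t) := deriv_comp_sub_const ..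
    rw [ht, hx, iteratedDeriv_comp_sub_const, iteratedDeriv_comp_sub_const]
    simp only [Nat.cast_ofNat] at hkey
    linear_combination hkey

/-- The real functions `V = Re ℘` and `W = Re ℘'` satisfy on the real axis the equations of `℘` and
`℘'`, since `℘` is real there, and the profile is a polynomial in `V`. -/
lemma isKawaharaWeierstrassWave_of_hasInvariants {κ α β : ℝ} (hκ : κ ≠ 0) (hβ : β ≠ 0) (c : ℝ)
    (L : PeriodPair) (hL : HasInvariants L (kawaharaG₂ α β c) (kawaharaG₃ α β c)) :
    IsKawaharaWeierstrassWave κ α β c L := by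
  set S : Set ℝ := {ξ : ℝ | (ξ : ℂ) ∉ L.lattice}
  set V : ℝ → ℝ := fun ξ => (L.weierstrassP ξ).re
  set W : ℝ → ℝ := fun ξ => (L.derivWeierstrassP ξ).re
  have hS : IsOpen S := L.isOpen_compl_lattice.preimage Complex.continuous_ofReal
  have hreal : ∀ ξ ∈ S, ((V ξ : ℝ) : ℂ) = L.weierstrassP ξ := fun ξ hξ =>
    L.ofReal_re_weierstrassP hL.1 hL.2 hξ
  have hV : ∀ ξ ∈ S, HasDerivAt V (W ξ) ξ := fun ξ hξ =>
    (L.hasDerivAt_weierstrassP hξ).real_of_complex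
  have hreal' : ∀ ξ ∈ S, ((W ξ : ℝ) : ℂ) = L.derivWeierstrassP ξ := fun ξ hξ => by
    refine (hV ξ hξ).ofReal_comp.unique
      ((L.hasDerivAt_weierstrassP hξ).comp_ofReal.congr_of_eventuallyEq ?_)
    filter_upwards [hS.mem_nhds hξ] with y hy using hreal y hy
  have hW : ∀ ξ ∈ S, HasDerivAt W (6 * V ξ ^ 2 - kawaharaG₂ α β c / 2) ξ := fun ξ hξ => by
    have h := (L.hasDerivAt_derivWeierstrassP hξ).real_of_complex
    rw [hL.1, ← hreal ξ hξ] at h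
    convert h using 1
    norm_cast
  have hsq : ∀ ξ ∈ S, W ξ ^ 2 = 4 * V ξ ^ 3 - kawaharaG₂ α β c * V ξ - kawaharaG₃ α β c :=
    fun ξ hξ => by
      have h := L.derivWeierstrassP_sq ξ hξ
      rw [hL.1, hL.2, ← hreal ξ hξ, ← hreal' ξ hξ] at h
      exact_mod_cast h
  have hint : ∀ ξ ∈ S, -c * (kawaharaProfile κ α β).eval (V ξ)
      + κ / 2 * (kawaharaProfile κ α β).eval (V ξ) ^ 2
      + α * iteratedDeriv 2 (fun y => (kawaharaProfile κ α β).eval (V y)) ξ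
      - β * iteratedDeriv 4 (fun y => (kawaharaProfile κ α β).eval (V y)) ξ
      = kawaharaConst κ α β c := fun ξ hξ => by
    rw [iteratedDeriv_two_eval_comp hS hV hW hsq _ hξ,
      iteratedDeriv_four_eval_comp hS hV hW hsq _ hξ]
    exact kawaharaProfile_equation hκ hβ c (V ξ)
  have hVsmooth : ContDiffOn ℝ 5 V S := fun ξ hξ =>
    (L.analyticOnNhd_weierstrassP ξ hξ).contDiffAt.real_of_complex.contDiffWithinAt
  refine ⟨fun y => (kawaharaProfile κ α β).eval (V y), fun ξ hξ => ?_,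
    isKawaharaSolutionOn_of_profile hS ?_ hint, hint⟩
  · rw [← hreal ξ hξ]
    simp [kawaharaProfile]
  · exact (Polynomial.contDiff_aeval (𝕜 := ℝ) (kawaharaProfile κ α β) 5).comp_contDiffOn hVsmooth

lemma kawaharaG₂_eq_zero_iff {β : ℝ} (hβ : β ≠ 0) (α c : ℝ) :
    kawaharaG₂ α β c = 0 ↔ c = 22 * α ^ 2 / (169 * β) := by
  rw [kawaharaG₂, div_eq_zero_iff, or_iff_left (by positivity), eq_div_iff (by positivity),
    sub_eq_zero]
  constructor <;> intro h <;> linear_combination h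

lemma kawaharaG₃_equianharmonic {β : ℝ} (hβ : β ≠ 0) (α : ℝ) :
    kawaharaG₃ α β (22 * α ^ 2 / (169 * β))
      = -(31 * α ^ 3) / (2 ^ 4 * 3 ^ 3 * 5 * 13 ^ 3 * β ^ 3) := by
  rw [kawaharaG₃]
  field_simp
  ring

end

theorem mainTheorem4 (κ α β : ℝ) (hκ : κ ≠ 0) (hβ : β ≠ 0) :
    (∀ c : ℝ, kawaharaG₂ α β c ^ 3 - 27 * kawaharaG₃ α β c ^ 2 ≠ 0 →
      (∃ L : PeriodPair, HasInvariants L (kawaharaG₂ α β c) (kawaharaG₃ α β c)) ∧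
      ∀ L : PeriodPair, HasInvariants L (kawaharaG₂ α β c) (kawaharaG₃ α β c) →
        IsKawaharaWeierstrassWave κ α β c L) ∧
    (∀ c : ℝ, kawaharaG₂ α β c = 0 ↔ c = 22 * α ^ 2 / (169 * β)) ∧
    kawaharaG₃ α β (22 * α ^ 2 / (169 * β))
      = -(31 * α ^ 3) / (2 ^ 4 * 3 ^ 3 * 5 * 13 ^ 3 * β ^ 3) ∧
    (α ≠ 0 →
      (∃ L : PeriodPair,
        HasInvariants L 0 (-(31 * α ^ 3) / (2 ^ 4 * 3 ^ 3 * 5 * 13 ^ 3 * β ^ 3))) ∧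
      ∀ L : PeriodPair,
        HasInvariants L 0 (-(31 * α ^ 3) / (2 ^ 4 * 3 ^ 3 * 5 * 13 ^ 3 * β ^ 3)) →
          IsKawaharaWeierstrassWave κ α β (22 * α ^ 2 / (169 * β)) L) := by
  refine ⟨fun c hc => ⟨PeriodPair.exists_g₂_g₃_eq _ _ hc, fun L hL =>
    isKawaharaWeierstrassWave_of_hasInvariants hκ hβ c L hL⟩,
    kawaharaG₂_eq_zero_iff hβ α, kawaharaG₃_equianharmonic hβ α, fun hα => ⟨?_, fun L hL => ?_⟩⟩
  · refine PeriodPair.exists_g₂_g₃_eq _ _ ?_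
    have h : -(31 * α ^ 3) / (2 ^ 4 * 3 ^ 3 * 5 * 13 ^ 3 * β ^ 3) ≠ 0 :=
      div_ne_zero (neg_ne_zero.2 (by positivity)) (by positivity)
    simp [h]
  · refine isKawaharaWeierstrassWave_of_hasInvariants hκ hβ _ L ?_
    rwa [(kawaharaG₂_eq_zero_iff hβ α _).2 rfl, kawaharaG₃_equianharmonic hβ α]
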